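/- **Setting.** Fix an inventory $\Delta>0$ and constants $0<m\le M$. Let $\mathcal G$ be a given family of revenue functions, each of which is, on $[0,\Delta]$, concave, increasing (in the weak sense) and differentiable, and satisfies $g(0)=0$ and $g'(0)\in[m,M]$. An input is a nonempty finite sequence $\sigma=(g_1,\dots,g_T)$ of elements of $\mathcal G$, with $T$ arbitrary; $\Sigma$ is the set of all inputs. Selling quantities $v_1,\dots,v_T$ are feasible if $v_t\ge 0$ for all $t$ and $\sum_{t=1}^T v_t\le\Delta$; they earn $\sum_{t=1}^T g_t(v_t)$, and $\eta_{OPT}(\sigma)$ is the maximal revenue of feasible quantities (with $\eta_{OPT}=0$ for the empty sequence). A deterministic online algorithm $\mathcal A$ chooses $v_t$ as a function of $g_1,\dots,g_t$ only (it knows neither the future functions nor $T$); it is feasible if its quantities are feasible for every $\sigma\in\Sigma$. Writing $\eta_{\mathcal A}(\sigma)$ for its revenue, its competitive ratio is $\sup_{\sigma\in\Sigma}\eta_{OPT}(\sigma)/\eta_{\mathcal A}(\sigma)\in[1,\infty]$. For $\pi\ge 1$, CR-Pursuit($\pi$) sells at time $t$ a quantity $\bar v_t\in[0,\Delta]$ with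 $$g_t(\bar v_t)=\frac1\pi\Bigl[\eta_{OPT}(g_1,\dots,g_t)-\eta_{OPT}(g_1,\dots,g_{t-1})\Bigr].$$ Let $\Phi_\Delta(\pi)=\sup\sum_{t=1}^T\bar v_t\in[0,\infty]$, the supremum being over all $\sigma=(g_1,\dots,g_T)\in\Sigma$ (and over all admissible choices of the $\bar v_t$, where these are not unique). CR-Pursuit($\pi$) is called feasible if $\Phi_\Delta(\pi)\le\Delta$. **Theorem.** Let $\pi^*\ge 1$ be a solution of the characteristic equation $\Phi_\Delta(\pi)=\Delta$. Then it is the only solution in $[1,\infty)$. CR-Pursuit($\pi^*$) is feasible: algorithms following its rule exist, and each of them is a feasible deterministic online algorithm with competitive ratio exactly $\pi^*$. Moreover $\pi^*$ is the optimal competitive ratio: it is the least competitive ratio among all feasible deterministic online algorithms. -/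

import Mathlib

open scoped ENNReal

noncomputable section

namespace OOIC

/-- `g` is an admissible revenue function for inventory `Δ` and base price bounds `m`, `M`: on
`[0, Δ]` it is concave, increasing (selling more never decreases revenue) and differentiable
(one-sidedly at the end points), `g 0 = 0`, and the base price `g'(0)` lies in `[m, M]`. -/
structure IsRevenueFunction (Δ m M : ℝ) (g : ℝ → ℝ) : Prop where
  concave : ConcaveOn ℝ (Set.Icc 0 Δ) g
  increasing : MonotoneOn g (Set.Icc 0 Δ)
  differentiable : DifferentiableOn ℝ g (Set.Icc 0 Δ)
  zero : g 0 = 0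
  basePrice : derivWithin g (Set.Icc 0 Δ) 0 ∈ Set.Icc m M

/-- The set of all possible inputs: nonempty finite sequences of revenue functions from the
family `𝒢`, of arbitrary length `T`. -/
def inputs (𝒢 : Set (ℝ → ℝ)) : Set (List (ℝ → ℝ)) :=
  {σ | σ ≠ [] ∧ ∀ g ∈ σ, g ∈ 𝒢}

/-- The vectors of selling quantities for `σ` that satisfy the constraints of the problem:
nonnegative quantities whose sum does not exceed the inventory `Δ`. -/
def feasibleSet (Δ : ℝ) (σ : List (ℝ → ℝ)) : Set (Fin σ.length → ℝ) :=
  {v | (∀ t, 0 ≤ v t) ∧ ∑ t, v t ≤ Δ}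

/-- The aggregate revenue of the selling quantities `v` under the input `σ`. -/
def revenue (σ : List (ℝ → ℝ)) (v : Fin σ.length → ℝ) : ℝ :=
  ∑ t, σ.get t (v t)

/-- The optimal offline revenue of the input `σ`. -/
def optRevenue (Δ : ℝ) (σ : List (ℝ → ℝ)) : ℝ :=
  sSup (revenue σ '' feasibleSet Δ σ)

/-- A deterministic online algorithm: given the revenue functions observed so far, including the
current one, it returns the quantity to sell in the current slot. It knows neither the future
functions nor the number of slots. -/
abbrev OnlineAlgorithm : Type := List (ℝ → ℝ) → ℝ

/-- The quantities that the online algorithm `A` sells under the input `σ`. -/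
def OnlineAlgorithm.decisions (A : OnlineAlgorithm) (σ : List (ℝ → ℝ)) : Fin σ.length → ℝ :=
  fun t => A (σ.take (t + 1))

/-- `A` respects the constraints of the problem under every input. -/
def OnlineAlgorithm.IsFeasible (𝒢 : Set (ℝ → ℝ)) (Δ : ℝ) (A : OnlineAlgorithm) : Prop :=
  ∀ σ ∈ inputs 𝒢, A.decisions σ ∈ feasibleSet Δ σ

/-- The competitive ratio of `A`: the worst case over all inputs of the ratio of the optimal
offline revenue to the revenue of `A`, which is `∞` if `A` earns nothing while the offline
optimum is positive. -/
def OnlineAlgorithm.competitiveRatio (𝒢 : Set (ℝ → ℝ)) (Δ : ℝ) (A : OnlineAlgorithm) : ℝ≥0∞ :=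
  ⨆ σ ∈ inputs 𝒢, ENNReal.ofReal (optRevenue Δ σ) / ENNReal.ofReal (revenue σ (A.decisions σ))

/-- `v` is an output of CR-Pursuit(`π`) under the input `σ`: at every slot `t` the quantity `v t`
is an element of `[0, Δ]` whose revenue is `1 / π` times the increment of the optimal offline
revenue caused by the arrival of the `t`-th function. -/
def IsCRPursuitOutput (Δ π : ℝ) (σ : List (ℝ → ℝ)) (v : Fin σ.length → ℝ) : Prop :=
  ∀ t : Fin σ.length, v t ∈ Set.Icc 0 Δ ∧
    σ.get t (v t) =
      (1 / π) * (optRevenue Δ (σ.take (t + 1)) - optRevenue Δ (σ.take t))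

/-- `A` is an implementation of CR-Pursuit(`π`). -/
def OnlineAlgorithm.IsCRPursuit (𝒢 : Set (ℝ → ℝ)) (Δ π : ℝ) (A : OnlineAlgorithm) : Prop :=
  ∀ σ ∈ inputs 𝒢, IsCRPursuitOutput Δ π σ (A.decisions σ)

/-- `Φ_Δ(π)`: the worst case, over all inputs, of the total quantity sold by
CR-Pursuit(`π`). -/
def worstCaseInventory (𝒢 : Set (ℝ → ℝ)) (Δ π : ℝ) : ℝ≥0∞ :=
  ⨆ σ ∈ inputs 𝒢, ⨆ (v : Fin σ.length → ℝ) (_ : IsCRPursuitOutput Δ π σ v),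
    ENNReal.ofReal (∑ t, v t)

/-- CR-Pursuit(`π`) is feasible: its worst-case total sales do not exceed the inventory. -/
def CRPursuitFeasible (𝒢 : Set (ℝ → ℝ)) (Δ π : ℝ) : Prop :=
  worstCaseInventory 𝒢 Δ π ≤ ENNReal.ofReal Δ

end OOIC

end

namespace OOIC

variable {Δ m M : ℝ} {g : ℝ → ℝ} {σ τ : List (ℝ → ℝ)}

/-! ### Revenue functions -/

/-! Uniqueness is a scaling argument. Raising the parameter from `r` to `s` multiplies every target
by `r / s`; by concavity and `g 0 = 0`, that fraction of the old quantity already earns the new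
target. Hence worst-case sales shrink by at least the factor `r / s` (`sum_le_total_pursuit`), and
two parameters cannot both exhaust `Δ`. The ratio of CR-Pursuit is a telescoping sum.

For optimality, suppose a feasible algorithm beats `π`, and take `q > 1` strictly between its ratio
and `π`. It suffices that `pursuit Δ q` never sells more than `Δ` (`total_pursuit_le`): scaling from
`q` to `π` then contradicts the characteristic equation.

Call the marginal revenue at the pursuit quantity the price. An exchange argument (`pursuit_swap`),
resting on submodularity of the offline optimum, reorders any input so that prices are nondecreasing
and pursuit sells no less. On such an input the competitor's revenue surplus over `1 / q` of the
optimum is nonnegative at every prefix. Tangent bounds convert surplus into extra quantity, and Abel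
summation against the increasing prices (`div_price_le_total_sub`) shows that the competitor sells
at least as much as pursuit, hence pursuit at most `Δ`. -/

lemma IsRevenueFunction.nonneg (hg : IsRevenueFunction Δ m M g) {v : ℝ}
    (hv : v ∈ Set.Icc 0 Δ) : 0 ≤ g v := by
  have := hg.increasing ⟨le_rfl, hv.1.trans hv.2⟩ hv hv.1
  rwa [hg.zero] at this

/-- Otherwise `g` would vanish on all of `[0, Δ]`, forcing a base price of `0 < m`. -/
lemma IsRevenueFunction.pos (hΔ : 0 < Δ) (hm : 0 < m) (hg : IsRevenueFunction Δ m M g) :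
    0 < g Δ := by
  by_contra! hle
  have h0 : derivWithin g (Set.Icc 0 Δ) 0 = derivWithin (fun _ => (0 : ℝ)) (Set.Icc 0 Δ) 0 :=
    derivWithin_congr
      (fun x hx => le_antisymm ((hg.increasing hx ⟨hΔ.le, le_rfl⟩ hx.2).trans hle) (hg.nonneg hx))
      hg.zero
  have h1 := hg.basePrice.1
  rw [h0, derivWithin_fun_const] at h1
  exact absurd h1 (by simpa using hm)

/-- A concave function lies below its tangents. -/
lemma IsRevenueFunction.le_tangent (hg : IsRevenueFunction Δ m M g) {v u : ℝ}
    (hv : v ∈ Set.Icc 0 Δ) (hu : u ∈ Set.Icc 0 Δ) :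
    g u ≤ g v + derivWithin g (Set.Icc 0 Δ) v * (u - v) := by
  rcases lt_trichotomy u v with h | rfl | h
  · have := hg.concave.derivWithin_le_slope hu hv h (hg.differentiable v hv)
    rw [slope_def_field, le_div_iff₀ (by linarith)] at this
    linarith
  · simp
  · have := hg.concave.slope_le_derivWithin hv hu h (hg.differentiable v hv)
    rw [slope_def_field, div_le_iff₀ (by linarith)] at this
    linarith

lemma IsRevenueFunction.derivWithin_pos (hg : IsRevenueFunction Δ m M g) {v : ℝ}
    (hv : v ∈ Set.Icc 0 Δ) (h : g v < g Δ) : 0 < derivWithin g (Set.Icc 0 Δ) v := by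
  have h1 := hg.le_tangent hv ⟨hv.1.trans hv.2, le_rfl⟩
  by_contra! hle
  nlinarith [hv.2]

/-- Below its maximal level a revenue function is strictly increasing. -/
lemma IsRevenueFunction.lt_of_lt (hg : IsRevenueFunction Δ m M g) {v u : ℝ}
    (hv : v ∈ Set.Icc 0 Δ) (hu : u ∈ Set.Icc 0 Δ) (hvu : v < u) (h : g v < g Δ) : g v < g u := by
  by_contra! hle
  have h1 := hg.le_tangent hu ⟨hv.1.trans hv.2, le_rfl⟩
  have h2 := hg.le_tangent hu hv
  have h3 : derivWithin g (Set.Icc 0 Δ) u ≤ 0 := by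
    by_contra! hp
    nlinarith
  nlinarith [hu.2]

lemma IsRevenueFunction.mul_le (hg : IsRevenueFunction Δ m M g) {v a : ℝ}
    (hv : v ∈ Set.Icc 0 Δ) (ha0 : 0 ≤ a) (ha1 : a ≤ 1) : a * g v ≤ g (a * v) := by
  have := hg.concave.2 hv ⟨le_rfl, hv.1.trans hv.2⟩ ha0 (sub_nonneg.2 ha1) (by ring)
  simpa [hg.zero] using this

/-! ### The optimal offline revenue -/

lemma revenue_cons (g : ℝ → ℝ) (σ : List (ℝ → ℝ)) (v : Fin (g :: σ).length → ℝ) :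
    revenue (g :: σ) v = g (v ⟨0, Nat.succ_pos _⟩) + revenue σ (fun t => v t.succ) :=
  Fin.sum_univ_succ (n := σ.length) _

lemma isCompact_feasibleSet (y : ℝ) (σ : List (ℝ → ℝ)) : IsCompact (feasibleSet y σ) := by
  refine IsCompact.of_isClosed_subset
    (isCompact_Icc (a := fun _ : Fin σ.length => (0 : ℝ)) (b := fun _ => y)) ?_ ?_
  · have : feasibleSet y σ = (⋂ t, {v | 0 ≤ v t}) ∩ {v | ∑ t, v t ≤ y} := by
      ext v; simp [feasibleSet]
    rw [this]
    exact (isClosed_iInter fun t => isClosed_le continuous_const (continuous_apply t)).inter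
      (isClosed_le (by fun_prop) continuous_const)
  · intro v hv
    exact ⟨hv.1, fun t =>
      (Finset.single_le_sum (fun s _ => hv.1 s) (Finset.mem_univ t)).trans hv.2⟩

lemma mem_Icc_of_mem_feasibleSet {y : ℝ} (hy : y ≤ Δ) {v : Fin σ.length → ℝ}
    (hv : v ∈ feasibleSet y σ) (t : Fin σ.length) : v t ∈ Set.Icc 0 Δ :=
  ⟨hv.1 t, ((Finset.single_le_sum (fun s _ => hv.1 s) (Finset.mem_univ t)).trans hv.2).trans hy⟩

lemma continuousOn_revenue (hσ : ∀ g ∈ σ, IsRevenueFunction Δ m M g) {y : ℝ} (hy : y ≤ Δ) :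
    ContinuousOn (revenue σ) (feasibleSet y σ) := by
  refine continuousOn_finsetSum _ fun t _ => ?_
  exact (hσ _ (List.get_mem σ t)).differentiable.continuousOn.comp
    (continuous_apply t).continuousOn fun v hv => mem_Icc_of_mem_feasibleSet hy hv t

lemma revenue_le_optRevenue (hσ : ∀ g ∈ σ, IsRevenueFunction Δ m M g) {y : ℝ} (hy : y ≤ Δ)
    {v : Fin σ.length → ℝ} (hv : v ∈ feasibleSet y σ) : revenue σ v ≤ optRevenue y σ :=
  le_csSup ((isCompact_feasibleSet y σ).image_of_continuousOn
    (continuousOn_revenue hσ hy)).bddAbove ⟨v, hv, rfl⟩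

/-- The optimal offline revenue is attained. -/
lemma exists_revenue_eq_optRevenue (hσ : ∀ g ∈ σ, IsRevenueFunction Δ m M g) {y : ℝ}
    (hy0 : 0 ≤ y) (hy : y ≤ Δ) : ∃ v ∈ feasibleSet y σ, revenue σ v = optRevenue y σ := by
  have hne : (feasibleSet y σ).Nonempty := ⟨fun _ => 0, fun _ => le_rfl, by simpa using hy0⟩
  exact ((isCompact_feasibleSet y σ).image_of_continuousOn
    (continuousOn_revenue hσ hy)).sSup_mem (hne.image _)

lemma optRevenue_nil {y : ℝ} (hy : 0 ≤ y) : optRevenue y [] = 0 := by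
  obtain ⟨v, -, h⟩ := exists_revenue_eq_optRevenue (Δ := y) (m := 0) (M := 0) (σ := [])
    (by simp) hy le_rfl
  rw [← h]
  exact Fin.sum_univ_zero _

/-! ### Recursion on the first slot and invariance under reordering -/

lemma optRevenue_add_le_cons (hg : IsRevenueFunction Δ m M g)
    (hσ : ∀ g ∈ σ, IsRevenueFunction Δ m M g) {y v : ℝ} (hy : y ≤ Δ) (hv : v ∈ Set.Icc 0 y) :
    optRevenue (y - v) σ + g v ≤ optRevenue y (g :: σ) := by
  obtain ⟨w, hw, hw'⟩ := exists_revenue_eq_optRevenue hσ (y := y - v) (by linarith [hv.2])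
    (by linarith [hv.1])
  have hgσ : ∀ f ∈ g :: σ, IsRevenueFunction Δ m M f := List.forall_mem_cons.2 ⟨hg, hσ⟩
  let w' : Fin (g :: σ).length → ℝ := Fin.cons (n := σ.length) (α := fun _ => ℝ) v w
  have hw'f : w' ∈ feasibleSet y (g :: σ) := by
    constructor
    · intro t
      refine Fin.cases (n := σ.length) (motive := fun t => 0 ≤ w' t) hv.1 (fun s => hw.1 s) t
    · have : ∑ t, w' t = v + ∑ t, w t := Fin.sum_univ_succ (n := σ.length) _
      rw [this]
      linarith [hw.2]
  have h := revenue_le_optRevenue hgσ hy hw'f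
  rw [revenue_cons] at h
  have h2 : g v + revenue σ w ≤ optRevenue y (g :: σ) := h
  linarith

lemma exists_optRevenue_cons_eq (hg : IsRevenueFunction Δ m M g)
    (hσ : ∀ g ∈ σ, IsRevenueFunction Δ m M g) {y : ℝ} (hy0 : 0 ≤ y) (hy : y ≤ Δ) :
    ∃ v ∈ Set.Icc 0 y, optRevenue y (g :: σ) = optRevenue (y - v) σ + g v := by
  have hgσ : ∀ f ∈ g :: σ, IsRevenueFunction Δ m M f := List.forall_mem_cons.2 ⟨hg, hσ⟩
  obtain ⟨w, hw, hw'⟩ := exists_revenue_eq_optRevenue hgσ hy0 hy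
  set v : ℝ := w ⟨0, Nat.succ_pos _⟩ with hv
  have hsum : ∑ t, w t = v + ∑ t : Fin σ.length, w t.succ := Fin.sum_univ_succ (n := σ.length) _
  have h0 : 0 ≤ ∑ t : Fin σ.length, w t.succ := Finset.sum_nonneg fun t _ => hw.1 _
  have hvy : v ∈ Set.Icc 0 y := ⟨hw.1 _, by linarith [hw.2]⟩
  refine ⟨v, hvy, le_antisymm ?_ (optRevenue_add_le_cons hg hσ hy hvy)⟩
  have htail : (fun t : Fin σ.length => w t.succ) ∈ feasibleSet (y - v) σ :=
    ⟨fun t => hw.1 _, by linarith [hw.2]⟩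
  have := revenue_le_optRevenue hσ (by linarith [hvy.1]) htail
  rw [← hw', revenue_cons]
  linarith

lemma optRevenue_swap_le {f : ℝ → ℝ} (hf : IsRevenueFunction Δ m M f)
    (hg : IsRevenueFunction Δ m M g) (hσ : ∀ g ∈ σ, IsRevenueFunction Δ m M g) {y : ℝ}
    (hy0 : 0 ≤ y) (hy : y ≤ Δ) : optRevenue y (f :: g :: σ) ≤ optRevenue y (g :: f :: σ) := by
  obtain ⟨v, hv, h1⟩ := exists_optRevenue_cons_eq hf (List.forall_mem_cons.2 ⟨hg, hσ⟩) hy0 hy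
  obtain ⟨w, hw, h2⟩ := exists_optRevenue_cons_eq hg hσ (y := y - v) (by linarith [hv.2])
    (by linarith [hv.1])
  have h3 := optRevenue_add_le_cons hf hσ (y := y - w) (v := v) (by linarith [hw.1])
    ⟨hv.1, by linarith [hw.2]⟩
  have h4 := optRevenue_add_le_cons hg (List.forall_mem_cons.2 ⟨hf, hσ⟩) hy (v := w)
    ⟨hw.1, by linarith [hw.2, hv.1]⟩
  rw [show y - w - v = y - v - w by ring] at h3
  linarith

/-- The inventory `y` is quantified inside the induction because the recursion hands the tail only
what the first slot leaves over. -/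
lemma optRevenue_perm (h : σ.Perm τ) (hσ : ∀ g ∈ σ, IsRevenueFunction Δ m M g) :
    ∀ y, 0 ≤ y → y ≤ Δ → optRevenue y σ = optRevenue y τ := by
  induction h with
  | nil => intros; rfl
  | cons f h ih =>
    intro y hy0 hy
    obtain ⟨hf, hσ⟩ := List.forall_mem_cons.1 hσ
    have hτ : ∀ g ∈ _, IsRevenueFunction Δ m M g := fun g hg => hσ g (h.mem_iff.2 hg)
    obtain ⟨v, hv, h1⟩ := exists_optRevenue_cons_eq hf hσ hy0 hy
    obtain ⟨w, hw, h2⟩ := exists_optRevenue_cons_eq hf hτ hy0 hy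
    have h3 := optRevenue_add_le_cons hf hτ hy hv
    have h4 := optRevenue_add_le_cons hf hσ hy hw
    have h5 := ih hσ (y - v) (by linarith [hv.2]) (by linarith [hv.1])
    have h6 := ih hσ (y - w) (by linarith [hw.2]) (by linarith [hw.1])
    linarith
  | swap f g l =>
    intro y hy0 hy
    simp only [List.forall_mem_cons] at hσ
    exact le_antisymm (optRevenue_swap_le hσ.1 hσ.2.1 hσ.2.2 hy0 hy)
      (optRevenue_swap_le hσ.2.1 hσ.1 hσ.2.2 hy0 hy)
  | trans h₁ h₂ ih₁ ih₂ =>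
    intro y hy0 hy
    exact (ih₁ hσ y hy0 hy).trans (ih₂ (fun g hg => hσ g (h₁.mem_iff.2 hg)) y hy0 hy)

/-! ### Concavity in the inventory and submodularity in the input -/

lemma concaveOn_optRevenue (hσ : ∀ g ∈ σ, IsRevenueFunction Δ m M g) :
    ConcaveOn ℝ (Set.Icc 0 Δ) (fun y => optRevenue y σ) := by
  refine ⟨convex_Icc 0 Δ, fun x hx y hy a b ha hb hab => ?_⟩
  obtain ⟨v, hv, h1⟩ := exists_revenue_eq_optRevenue hσ hx.1 hx.2
  obtain ⟨w, hw, h2⟩ := exists_revenue_eq_optRevenue hσ hy.1 hy.2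
  have hmem := convex_Icc 0 Δ hx hy ha hb hab
  have hfeas : a • v + b • w ∈ feasibleSet (a • x + b • y) σ := by
    constructor
    · intro t
      have := hv.1 t
      have := hw.1 t
      simp only [Pi.add_apply, Pi.smul_apply, smul_eq_mul]
      positivity
    · simp only [Pi.add_apply, Pi.smul_apply, smul_eq_mul, Finset.sum_add_distrib,
        ← Finset.mul_sum]
      exact add_le_add (mul_le_mul_of_nonneg_left hv.2 ha) (mul_le_mul_of_nonneg_left hw.2 hb)
  refine le_trans ?_ (revenue_le_optRevenue hσ hmem.2 hfeas)
  simp only [← h1, ← h2, revenue, Finset.smul_sum, ← Finset.sum_add_distrib]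
  exact Finset.sum_le_sum fun t _ => (hσ _ (List.get_mem σ t)).concave.2
    (mem_Icc_of_mem_feasibleSet hx.2 hv t) (mem_Icc_of_mem_feasibleSet hy.2 hw t) ha hb hab

/-- The two inner points are convex combinations of the outer ones with complementary weights, so
adding the two concavity inequalities gives the claim. -/
lemma _root_.ConcaveOn.add_le_add_of_nonneg {s : Set ℝ} {F : ℝ → ℝ} (hF : ConcaveOn ℝ s F)
    {x a b : ℝ} (ha : 0 ≤ a) (hb : 0 ≤ b) (hx : x ∈ s) (hy : x + a + b ∈ s) :
    F x + F (x + a + b) ≤ F (x + a) + F (x + b) := by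
  rcases (add_nonneg ha hb).eq_or_lt with h | h
  · have ha' : a = 0 := by linarith
    have hb' : b = 0 := by linarith
    simp [ha', hb']
  · have h1 := hF.2 hx hy (show 0 ≤ b / (a + b) by positivity)
      (show 0 ≤ a / (a + b) by positivity) (by field_simp; ring)
    have h2 := hF.2 hx hy (show 0 ≤ a / (a + b) by positivity)
      (show 0 ≤ b / (a + b) by positivity) (by field_simp)
    simp only [smul_eq_mul] at h1 h2
    rw [show b / (a + b) * x + a / (a + b) * (x + a + b) = x + a by field_simp; ring] at h1
    rw [show a / (a + b) * x + b / (a + b) * (x + a + b) = x + b by field_simp; ring] at h2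
    have h3 : a / (a + b) + b / (a + b) = 1 := by field_simp
    have h4 : a / (a + b) = 1 - b / (a + b) := by linarith
    rw [h4] at h1 h2
    linarith

/-- The optimal offline revenue is submodular in the set of revenue functions. -/
lemma optRevenue_submodular {f : ℝ → ℝ} (hf : IsRevenueFunction Δ m M f)
    (hg : IsRevenueFunction Δ m M g) (hσ : ∀ g ∈ σ, IsRevenueFunction Δ m M g) (hΔ : 0 ≤ Δ) :
    optRevenue Δ (f :: g :: σ) + optRevenue Δ σ ≤
      optRevenue Δ (f :: σ) + optRevenue Δ (g :: σ) := by
  obtain ⟨v, hv, h1⟩ := exists_optRevenue_cons_eq hf (List.forall_mem_cons.2 ⟨hg, hσ⟩) hΔ le_rfl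
  obtain ⟨w, hw, h2⟩ := exists_optRevenue_cons_eq hg hσ (y := Δ - v) (by linarith [hv.2])
    (by linarith [hv.1])
  have h3 := optRevenue_add_le_cons hf hσ le_rfl hv
  have h4 := optRevenue_add_le_cons hg hσ le_rfl (v := w) ⟨hw.1, by linarith [hw.2, hv.1]⟩
  -- With `v` and `w` the optimal sales to `f` and `g`, submodularity reduces to diminishing returns
  -- of inventory for `σ` between `Δ - v - w` and `Δ`.
  have h5 := (concaveOn_optRevenue hσ).add_le_add_of_nonneg (x := Δ - v - w) hw.1 hv.1
    ⟨by linarith [hw.2], by linarith [hw.1, hv.1]⟩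
    ⟨by linarith [hw.2, hv.2], by linarith [hw.1, hv.1]⟩
  simp only [show Δ - v - w + w = Δ - v by ring, sub_add_cancel,
    show Δ - v - w + v = Δ - w by ring] at h5
  linarith

lemma optRevenue_mono (hσ : ∀ g ∈ σ, IsRevenueFunction Δ m M g) {x y : ℝ} (hx : 0 ≤ x)
    (hxy : x ≤ y) (hy : y ≤ Δ) : optRevenue x σ ≤ optRevenue y σ := by
  obtain ⟨v, hv, h⟩ := exists_revenue_eq_optRevenue hσ hx (hxy.trans hy)
  rw [← h]
  exact revenue_le_optRevenue hσ hy ⟨hv.1, hv.2.trans hxy⟩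

lemma optRevenue_nonneg (hσ : ∀ g ∈ σ, IsRevenueFunction Δ m M g) {y : ℝ} (hy0 : 0 ≤ y)
    (hy : y ≤ Δ) : 0 ≤ optRevenue y σ := by
  obtain ⟨v, hv, h⟩ := exists_revenue_eq_optRevenue hσ hy0 hy
  rw [← h]
  exact Finset.sum_nonneg fun t _ =>
    (hσ _ (List.get_mem σ t)).nonneg (mem_Icc_of_mem_feasibleSet hy hv t)

lemma optRevenue_pos (hΔ : 0 < Δ) (hm : 0 < m) (hσ : ∀ g ∈ σ, IsRevenueFunction Δ m M g)
    (hne : σ ≠ []) : 0 < optRevenue Δ σ := by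
  obtain ⟨g, τ, rfl⟩ := List.exists_cons_of_ne_nil hne
  obtain ⟨hg, hτ⟩ := List.forall_mem_cons.1 hσ
  have h1 := optRevenue_add_le_cons hg hτ le_rfl ⟨hΔ.le, le_rfl⟩
  have h2 := optRevenue_nonneg hτ (y := Δ - Δ) (by simp) (by linarith)
  linarith [hg.pos hΔ hm]

/-- The increment of the optimal offline revenue caused by the arrival of a revenue function. -/
lemma optRevenue_concat_sub_mem (hΔ : 0 ≤ Δ) (hσ : ∀ f ∈ σ ++ [g], IsRevenueFunction Δ m M f) :
    optRevenue Δ (σ ++ [g]) - optRevenue Δ σ ∈ Set.Icc 0 (g Δ) := by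
  have hσ' : ∀ f ∈ σ, IsRevenueFunction Δ m M f := fun f hf => hσ f (by simp [hf])
  have hg : IsRevenueFunction Δ m M g := hσ g (by simp)
  rw [optRevenue_perm (List.perm_append_singleton g σ) hσ Δ hΔ le_rfl]
  have h1 := optRevenue_add_le_cons hg hσ' le_rfl ⟨le_rfl, hΔ⟩
  rw [sub_zero, hg.zero] at h1
  obtain ⟨v, hv, h2⟩ := exists_optRevenue_cons_eq hg hσ' hΔ le_rfl
  have h3 := hg.increasing hv ⟨hΔ, le_rfl⟩ hv.2
  have h4 := optRevenue_mono hσ' (x := Δ - v) (by linarith [hv.2]) (by linarith [hv.1]) le_rfl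
  constructor <;> linarith

end OOIC

namespace OOIC

variable {Δ m M r : ℝ} {g : ℝ → ℝ} {σ τ : List (ℝ → ℝ)}

/-! ### Sums over the slots of an input -/

/-- The sum over all slots of a quantity that depends on the functions observed so far. -/
def total (f : List (ℝ → ℝ) → ℝ) (σ : List (ℝ → ℝ)) : ℝ :=
  ∑ t : Fin σ.length, f (σ.take (t + 1))

lemma total_nil (f : List (ℝ → ℝ) → ℝ) : total f [] = 0 :=
  Fin.sum_univ_zero _

lemma total_concat (f : List (ℝ → ℝ) → ℝ) (σ : List (ℝ → ℝ)) (g : ℝ → ℝ) :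
    total f (σ ++ [g]) = total f σ + f (σ ++ [g]) := by
  have h (τ : List (ℝ → ℝ)) : total f τ = ∑ t ∈ Finset.range τ.length, f (τ.take (t + 1)) :=
    (Finset.sum_range fun t => f (τ.take (t + 1))).symm
  rw [h, h, List.length_append, List.length_singleton, Finset.sum_range_succ,
    List.take_of_length_le (by simp)]
  congr 1
  refine Finset.sum_congr rfl fun t ht => ?_
  rw [List.take_append_of_le_length (Finset.mem_range.1 ht)]

/-- The revenue that an algorithm earns in the last slot. -/
def slotRevenue (A : OnlineAlgorithm) (σ : List (ℝ → ℝ)) : ℝ :=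
  σ.getLastD 0 (A σ)

lemma slotRevenue_concat (A : OnlineAlgorithm) (σ : List (ℝ → ℝ)) (g : ℝ → ℝ) :
    slotRevenue A (σ ++ [g]) = g (A (σ ++ [g])) := by
  rw [slotRevenue, List.getLastD_concat]

lemma revenue_decisions (A : OnlineAlgorithm) (σ : List (ℝ → ℝ)) :
    revenue σ (A.decisions σ) = total (slotRevenue A) σ := by
  refine Finset.sum_congr rfl fun t _ => ?_
  rw [OnlineAlgorithm.decisions, List.take_succ_eq_append_getElem t.2, slotRevenue_concat]
  rfl

/-- Swapping two consecutive functions changes a total only in these two slots, if the summand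
is insensitive to the order of the earlier functions. -/
lemma total_swap {f : List (ℝ → ℝ) → ℝ} {p : (ℝ → ℝ) → Prop}
    (hf : ∀ (σ τ : List (ℝ → ℝ)) (g : ℝ → ℝ), σ.Perm τ → (∀ h ∈ σ ++ [g], p h) →
      f (σ ++ [g]) = f (τ ++ [g]))
    (l : List (ℝ → ℝ)) (a b : ℝ → ℝ) (l' : List (ℝ → ℝ)) (hp : ∀ h ∈ l ++ [a] ++ [b] ++ l', p h) :
    total f (l ++ [b] ++ [a] ++ l') - (f (l ++ [b]) + f (l ++ [b] ++ [a])) =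
      total f (l ++ [a] ++ [b] ++ l') - (f (l ++ [a]) + f (l ++ [a] ++ [b])) := by
  induction l' using List.reverseRecOn with
  | nil =>
    simp only [List.append_nil, total_concat]
    ring
  | append_singleton l' c ih =>
    have h1 := ih fun h hh => hp h (by simp only [List.mem_append] at hh ⊢; tauto)
    have h2 := hf (l ++ [a] ++ [b] ++ l') (l ++ [b] ++ [a] ++ l') c
      (by simpa using List.Perm.append_left l (List.Perm.swap b a l')) (by simpa using hp)
    rw [← List.append_assoc (l ++ [b] ++ [a]), ← List.append_assoc (l ++ [a] ++ [b]),
      total_concat, total_concat, ← h2]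
    linarith

/-! ### A canonical implementation of CR-Pursuit -/

open Classical in
/-- A quantity in `[0, Δ]` at which the revenue of `g` is `c`, if there is one. -/
noncomputable def quantity (Δ : ℝ) (g : ℝ → ℝ) (c : ℝ) : ℝ :=
  -- The choice depends only on `g` and `c`, so equal targets give equal quantities even on a
  -- plateau of `g`. The default `0` is not reached for targets in `[0, g Δ]`.
  if h : ∃ v ∈ Set.Icc 0 Δ, g v = c then h.choose else 0

/-- The revenue that CR-Pursuit(`r`) has to earn in the last slot. -/
noncomputable def target (Δ r : ℝ) (σ : List (ℝ → ℝ)) : ℝ :=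
  (1 / r) * (optRevenue Δ σ - optRevenue Δ σ.dropLast)

/-- An implementation of CR-Pursuit(`r`). -/
noncomputable def pursuit (Δ r : ℝ) : OnlineAlgorithm := fun σ =>
  quantity Δ (σ.getLastD 0) (target Δ r σ)

/-- The marginal revenue at the quantity that `pursuit Δ r` sells in the last slot. -/
noncomputable def price (Δ r : ℝ) (σ : List (ℝ → ℝ)) : ℝ :=
  derivWithin (σ.getLastD 0) (Set.Icc 0 Δ) (pursuit Δ r σ)

lemma quantity_spec {c : ℝ} (hΔ : 0 ≤ Δ) (hg : IsRevenueFunction Δ m M g)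
    (hc : c ∈ Set.Icc 0 (g Δ)) : quantity Δ g c ∈ Set.Icc 0 Δ ∧ g (quantity Δ g c) = c := by
  have h : ∃ v ∈ Set.Icc 0 Δ, g v = c :=
    intermediate_value_Icc hΔ hg.differentiable.continuousOn (by rwa [hg.zero])
  rw [quantity, dif_pos h]
  exact h.choose_spec

lemma target_concat (Δ r : ℝ) (σ : List (ℝ → ℝ)) (g : ℝ → ℝ) :
    target Δ r (σ ++ [g]) = (1 / r) * (optRevenue Δ (σ ++ [g]) - optRevenue Δ σ) := by
  rw [target, List.dropLast_concat]

lemma target_mem (hΔ : 0 ≤ Δ) (hr : 1 ≤ r) (hσ : ∀ f ∈ σ ++ [g], IsRevenueFunction Δ m M f) :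
    target Δ r (σ ++ [g]) ∈ Set.Icc 0 (g Δ) := by
  obtain ⟨h1, h2⟩ := optRevenue_concat_sub_mem hΔ hσ
  rw [target_concat]
  have h3 : 1 / r ≤ 1 := by rw [div_le_one (by linarith)]; exact hr
  exact ⟨by positivity, (mul_le_of_le_one_left h1 h3).trans h2⟩

/-- Strictness, which needs `1 < r`, keeps pursuit off the plateau of `g`; this makes prices
positive, so that they can be divided by. -/
lemma target_lt (hΔ : 0 < Δ) (hm : 0 < m) (hr : 1 < r)
    (hσ : ∀ f ∈ σ ++ [g], IsRevenueFunction Δ m M f) : target Δ r (σ ++ [g]) < g Δ := by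
  obtain ⟨h1, h2⟩ := optRevenue_concat_sub_mem hΔ.le hσ
  have h4 := (hσ g (by simp)).pos hΔ hm
  have h3 : 1 / r < 1 := by rw [div_lt_one (by linarith)]; exact hr
  have h0 : 0 < 1 / r := by positivity
  rw [target_concat]
  nlinarith

lemma target_perm (hΔ : 0 ≤ Δ) (h : σ.Perm τ) (hσ : ∀ f ∈ σ ++ [g], IsRevenueFunction Δ m M f) :
    target Δ r (σ ++ [g]) = target Δ r (τ ++ [g]) := by
  rw [target_concat, target_concat, optRevenue_perm (h.append_right [g]) hσ Δ hΔ le_rfl,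
    optRevenue_perm h (fun f hf => hσ f (by simp [hf])) Δ hΔ le_rfl]

lemma pursuit_concat (Δ r : ℝ) (σ : List (ℝ → ℝ)) (g : ℝ → ℝ) :
    pursuit Δ r (σ ++ [g]) = quantity Δ g (target Δ r (σ ++ [g])) := by
  rw [pursuit, List.getLastD_concat]

lemma price_concat (Δ r : ℝ) (σ : List (ℝ → ℝ)) (g : ℝ → ℝ) :
    price Δ r (σ ++ [g]) =
      derivWithin g (Set.Icc 0 Δ) (quantity Δ g (target Δ r (σ ++ [g]))) := by
  rw [price, List.getLastD_concat, pursuit_concat]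

lemma pursuit_mem (hΔ : 0 ≤ Δ) (hr : 1 ≤ r) (hσ : ∀ f ∈ σ ++ [g], IsRevenueFunction Δ m M f) :
    pursuit Δ r (σ ++ [g]) ∈ Set.Icc 0 Δ := by
  rw [pursuit_concat]
  exact (quantity_spec hΔ (hσ g (by simp)) (target_mem hΔ hr hσ)).1

lemma apply_pursuit (hΔ : 0 ≤ Δ) (hr : 1 ≤ r) (hσ : ∀ f ∈ σ ++ [g], IsRevenueFunction Δ m M f) :
    g (pursuit Δ r (σ ++ [g])) = target Δ r (σ ++ [g]) := by
  rw [pursuit_concat]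
  exact (quantity_spec hΔ (hσ g (by simp)) (target_mem hΔ hr hσ)).2

lemma price_pos (hΔ : 0 < Δ) (hm : 0 < m) (hr : 1 < r)
    (hσ : ∀ f ∈ σ ++ [g], IsRevenueFunction Δ m M f) : 0 < price Δ r (σ ++ [g]) := by
  rw [price_concat, ← pursuit_concat]
  refine (hσ g (by simp)).derivWithin_pos (pursuit_mem hΔ.le hr.le hσ) ?_
  rw [apply_pursuit hΔ.le hr.le hσ]
  exact target_lt hΔ hm hr hσ

/-- Selling `u` rather than the pursuit quantity changes the revenue by at most `price` times the
change of the quantity. -/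
lemma sub_target_le (hΔ : 0 < Δ) (hm : 0 < m) (hr : 1 < r)
    (hσ : ∀ f ∈ σ ++ [g], IsRevenueFunction Δ m M f) {u : ℝ} (hu : u ∈ Set.Icc 0 Δ) :
    (g u - target Δ r (σ ++ [g])) / price Δ r (σ ++ [g]) ≤ u - pursuit Δ r (σ ++ [g]) := by
  rw [div_le_iff₀ (price_pos hΔ hm hr hσ)]
  have h := (hσ g (by simp)).le_tangent (pursuit_mem hΔ.le hr.le hσ) hu
  rw [apply_pursuit hΔ.le hr.le hσ, pursuit_concat, ← price_concat, ← pursuit_concat] at h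
  linarith

lemma target_eq_of_isCRPursuitOutput {v : Fin σ.length → ℝ} (hv : IsCRPursuitOutput Δ r σ v)
    (t : Fin σ.length) : σ.get t (v t) = target Δ r (σ.take t ++ [σ[t]]) := by
  have := (hv t).2
  rw [List.take_succ_eq_append_getElem t.2] at this
  rw [target_concat]
  exact this

lemma take_concat_mem {p : (ℝ → ℝ) → Prop} (hσ : ∀ f ∈ σ, p f) (t : Fin σ.length) :
    ∀ f ∈ σ.take t ++ [σ[t]], p f := by
  intro f hf
  rw [Fin.getElem_fin, ← List.take_succ_eq_append_getElem t.2] at hf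
  exact hσ f (List.mem_of_mem_take hf)

lemma isCRPursuitOutput_pursuit (hΔ : 0 ≤ Δ) (hr : 1 ≤ r)
    (hσ : ∀ f ∈ σ, IsRevenueFunction Δ m M f) :
    IsCRPursuitOutput Δ r σ ((pursuit Δ r).decisions σ) := by
  intro t
  have h := take_concat_mem hσ t
  have h1 := pursuit_mem hΔ hr h
  have h2 := apply_pursuit hΔ hr h
  rw [target_concat] at h2
  rw [OnlineAlgorithm.decisions, List.take_succ_eq_append_getElem t.2]
  exact ⟨h1, h2⟩

/-- CR-Pursuit with a larger parameter `s` sells at most the fraction `r / s` of what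
CR-Pursuit(`r`) sells. -/
lemma sum_le_total_pursuit (hΔ : 0 < Δ) (hm : 0 < m) {s : ℝ} (hr : 1 ≤ r) (hrs : r < s)
    (hσ : ∀ f ∈ σ, IsRevenueFunction Δ m M f) {v : Fin σ.length → ℝ}
    (hv : IsCRPursuitOutput Δ s σ v) : ∑ t, v t ≤ r / s * total (pursuit Δ r) σ := by
  rw [total, Finset.mul_sum]
  refine Finset.sum_le_sum fun t _ => ?_
  have hs : 1 < s := by linarith
  have h := take_concat_mem hσ t
  have hg : IsRevenueFunction Δ m M σ[t] := hσ _ (List.getElem_mem _)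
  rw [List.take_succ_eq_append_getElem t.2]
  set w := pursuit Δ r (σ.take t ++ [σ[t]]) with hw
  have hw1 : w ∈ Set.Icc 0 Δ := pursuit_mem hΔ.le hr h
  have hq0 : 0 ≤ r / s := by positivity
  have hq1 : r / s ≤ 1 := by rw [div_le_one (by linarith)]; exact hrs.le
  have hvt : σ[t] (v t) = target Δ s (σ.take t ++ [σ[t]]) := target_eq_of_isCRPursuitOutput hv t
  have hscale : target Δ s (σ.take t ++ [σ[t]]) = r / s * target Δ r (σ.take t ++ [σ[t]]) := by
    rw [target_concat, target_concat]
    field_simp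
  have hmul := hg.mul_le hw1 hq0 hq1
  rw [hw, apply_pursuit hΔ.le hr h, ← hw, ← hscale, ← hvt] at hmul
  -- The target for `s` lies below the maximum of the function, where it is strictly increasing; so
  -- no admissible choice of `v t` can exceed `r / s * w`.
  by_contra! hlt
  have hmem : r / s * w ∈ Set.Icc 0 Δ :=
    ⟨mul_nonneg hq0 hw1.1, (mul_le_of_le_one_left hw1.1 hq1).trans hw1.2⟩
  have hle := hg.increasing hmem (hv t).1 hlt.le
  have hlt' : σ[t] (r / s * w) < σ[t] Δ := by
    refine hle.trans_lt ?_
    rw [hvt]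
    exact target_lt hΔ hm hs h
  exact absurd (hg.lt_of_lt hmem (hv t).1 hlt hlt') (not_lt.2 hmul)

/-! ### Inputs with nondecreasing prices -/

/-- Swapping two consecutive functions with decreasing prices does not decrease the total sales of
`pursuit`, and if it leaves them unchanged it also exchanges the two prices. -/
lemma pursuit_swap (hΔ : 0 < Δ) (hm : 0 < m) (hr : 1 < r) {l l' : List (ℝ → ℝ)} {a b : ℝ → ℝ}
    (hσ : ∀ f ∈ l ++ [a] ++ [b] ++ l', IsRevenueFunction Δ m M f)
    (hprice : price Δ r (l ++ [a] ++ [b]) < price Δ r (l ++ [a])) :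
    total (pursuit Δ r) (l ++ [a] ++ [b] ++ l') < total (pursuit Δ r) (l ++ [b] ++ [a] ++ l') ∨
    total (pursuit Δ r) (l ++ [a] ++ [b] ++ l') = total (pursuit Δ r) (l ++ [b] ++ [a] ++ l') ∧
      total (fun τ => τ.length * price Δ r τ) (l ++ [a] ++ [b] ++ l') <
        total (fun τ => τ.length * price Δ r τ) (l ++ [b] ++ [a] ++ l') := by
  have hab : ∀ f ∈ l ++ [a] ++ [b], IsRevenueFunction Δ m M f := fun f hf => hσ f (by
    simp only [List.mem_append] at hf ⊢; tauto)
  have hperm : (l ++ [a] ++ [b]).Perm (l ++ [b] ++ [a]) := by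
    simpa using List.Perm.append_left l (List.Perm.swap b a [])
  have hba : ∀ f ∈ l ++ [b] ++ [a], IsRevenueFunction Δ m M f := fun f hf =>
    hab f (hperm.mem_iff.2 hf)
  have ha : ∀ f ∈ l ++ [a], IsRevenueFunction Δ m M f := fun f hf => hab f (by
    simp only [List.mem_append] at hf ⊢; tauto)
  have hb : ∀ f ∈ l ++ [b], IsRevenueFunction Δ m M f := fun f hf => hba f (by
    simp only [List.mem_append] at hf ⊢; tauto)
  have hl : ∀ f ∈ l, IsRevenueFunction Δ m M f := fun f hf => ha f (by simp [hf])
  have hpa := price_pos hΔ hm hr ha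
  have hpb := price_pos hΔ hm hr hab
  have hr0 : 0 < 1 / r := by positivity
  have hsum : target Δ r (l ++ [a]) + target Δ r (l ++ [a] ++ [b]) =
      target Δ r (l ++ [b]) + target Δ r (l ++ [b] ++ [a]) := by
    simp only [target_concat]
    rw [optRevenue_perm hperm hab Δ hΔ.le le_rfl]
    ring
  have hsub : target Δ r (l ++ [b] ++ [a]) ≤ target Δ r (l ++ [a]) := by
    have h1 := optRevenue_submodular (ha a (by simp)) (hb b (by simp)) hl hΔ.le
    have e1 := optRevenue_perm (List.perm_append_singleton a l) ha Δ hΔ.le le_rfl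
    have e2 := optRevenue_perm (List.perm_append_singleton b l) hb Δ hΔ.le le_rfl
    have e3 := optRevenue_perm (τ := a :: b :: l) ((List.perm_append_singleton a _).trans
      ((List.perm_append_singleton b l).cons a)) hba Δ hΔ.le le_rfl
    simp only [target_concat]
    apply mul_le_mul_of_nonneg_left _ hr0.le
    linarith
  have hswap := total_swap (f := pursuit Δ r) (p := IsRevenueFunction Δ m M)
    (fun σ τ g h hσ => by rw [pursuit_concat, pursuit_concat, target_perm hΔ.le h hσ]) l a b l' hσ
  have hswap' := total_swap (f := fun τ => τ.length * price Δ r τ) (p := IsRevenueFunction Δ m M)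
    (fun σ τ g h hσ => by
      simp only [price_concat, target_perm hΔ.le h hσ, List.length_append, h.length_eq]) l a b l' hσ
  rcases hsub.lt_or_eq with hlt | heq
  · left
    -- After the swap `a` gives up the revenue `d` and `b` takes it on. This saves at most `d` over
    -- the price of `a` and costs at least `d` over the smaller price of `b`.
    have h1 := sub_target_le hΔ hm hr ha (pursuit_mem hΔ.le hr.le hba)
    have h2 := sub_target_le hΔ hm hr hab (pursuit_mem hΔ.le hr.le hb)
    rw [apply_pursuit hΔ.le hr.le hba] at h1
    rw [apply_pursuit hΔ.le hr.le hb] at h2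
    set d := target Δ r (l ++ [a]) - target Δ r (l ++ [b] ++ [a]) with hd
    rw [show target Δ r (l ++ [b] ++ [a]) - target Δ r (l ++ [a]) = -d by ring, neg_div] at h1
    rw [show target Δ r (l ++ [b]) - target Δ r (l ++ [a] ++ [b]) = d by linarith] at h2
    have h3 : d / price Δ r (l ++ [a]) < d / price Δ r (l ++ [a] ++ [b]) :=
      div_lt_div_of_pos_left (by linarith) hpb hprice
    linarith
  · right
    -- Without a shift of revenue both functions keep quantity and price. Weighting prices by
    -- position then makes the swap a strict gain, since the larger price moves later.
    have heq' : target Δ r (l ++ [b]) = target Δ r (l ++ [a] ++ [b]) := by linarith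
    have q1 : pursuit Δ r (l ++ [b] ++ [a]) = pursuit Δ r (l ++ [a]) := by
      rw [pursuit_concat, pursuit_concat, heq]
    have q2 : pursuit Δ r (l ++ [b]) = pursuit Δ r (l ++ [a] ++ [b]) := by
      rw [pursuit_concat, pursuit_concat, heq']
    have p1 : price Δ r (l ++ [b] ++ [a]) = price Δ r (l ++ [a]) := by
      rw [price_concat, price_concat, heq]
    have p2 : price Δ r (l ++ [b]) = price Δ r (l ++ [a] ++ [b]) := by
      rw [price_concat, price_concat, heq']
    constructor
    · linarith
    · simp only [p1, p2, List.length_append, List.length_singleton] at hswap'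
      push_cast at hswap'
      linarith

/-- Every input can be reordered such that the sales of `pursuit` do not decrease and the prices at
which it sells are nondecreasing. -/
lemma exists_perm_price_le (hΔ : 0 < Δ) (hm : 0 < m) (hr : 1 < r)
    (hσ : ∀ f ∈ σ, IsRevenueFunction Δ m M f) :
    ∃ τ : List (ℝ → ℝ), τ.Perm σ ∧ total (pursuit Δ r) σ ≤ total (pursuit Δ r) τ ∧
      ∀ l a b, l ++ [a] ++ [b] <+: τ → price Δ r (l ++ [a]) ≤ price Δ r (l ++ [a] ++ [b]) := by
  classical
  -- A lexicographic maximiser over the finitely many reorderings: sales first, position-weighted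
  -- prices as tie-break. A descent in price would contradict maximality.
  obtain ⟨τ, hτ, hmax⟩ := Finset.exists_max_image σ.permutations.toFinset
    (fun τ => toLex (total (pursuit Δ r) τ, total (fun τ => τ.length * price Δ r τ) τ))
    ⟨σ, by simp⟩
  simp only [List.mem_toFinset, List.mem_permutations] at hτ hmax
  refine ⟨τ, hτ, ?_, ?_⟩
  · have := hmax σ (List.Perm.refl σ)
    rcases Prod.Lex.toLex_le_toLex.1 this with h | h
    exacts [h.le, h.1.le]
  · rintro l a b ⟨l', rfl⟩
    by_contra! hlt
    have hmem : ∀ f ∈ l ++ [a] ++ [b] ++ l', IsRevenueFunction Δ m M f := fun f hf =>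
      hσ f (hτ.mem_iff.1 hf)
    have hperm : (l ++ [b] ++ [a] ++ l').Perm (l ++ [a] ++ [b] ++ l') := by
      simpa using List.Perm.append_left l (List.Perm.swap a b l')
    refine absurd (hmax _ (hperm.trans hτ)) (not_le.2 ?_)
    rw [Prod.Lex.toLex_lt_toLex]
    exact pursuit_swap hΔ hm hr hmem hlt

/-- On an input with nondecreasing prices, an algorithm that is `r`-competitive at every time sells
at least as much as `pursuit`. -/
lemma div_price_le_total_sub (hΔ : 0 < Δ) (hm : 0 < m) (hr : 1 < r) (A : OnlineAlgorithm)
    (l : List (ℝ → ℝ)) : ∀ g, (∀ f ∈ l ++ [g], IsRevenueFunction Δ m M f) →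
    (∀ l' a b, l' ++ [a] ++ [b] <+: l ++ [g] →
      price Δ r (l' ++ [a]) ≤ price Δ r (l' ++ [a] ++ [b])) →
    (∀ l' a, l' ++ [a] <+: l ++ [g] → A (l' ++ [a]) ∈ Set.Icc 0 Δ ∧
      1 / r * optRevenue Δ (l' ++ [a]) ≤ total (slotRevenue A) (l' ++ [a])) →
    (total (slotRevenue A) (l ++ [g]) - 1 / r * optRevenue Δ (l ++ [g])) / price Δ r (l ++ [g]) ≤
      total A (l ++ [g]) - total (pursuit Δ r) (l ++ [g]) := by
  induction l using List.reverseRecOn with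
  | nil =>
    intro g hσ _ hA
    have h := sub_target_le hΔ hm hr (σ := []) hσ (hA [] g (List.prefix_refl _)).1
    rw [target_concat, optRevenue_nil hΔ.le, sub_zero] at h
    simpa only [total_concat, total_nil, slotRevenue_concat, zero_add] using h
  | append_singleton l c ih =>
    intro g hσ hsort hA
    have hpre : l ++ [c] <+: l ++ [c] ++ [g] := List.prefix_append _ _
    have hc : ∀ f ∈ l ++ [c], IsRevenueFunction Δ m M f := fun f hf => hσ f (by
      simp only [List.mem_append] at hf ⊢; tauto)
    have h1 := ih c hc (fun l' a b h => hsort l' a b (h.trans hpre))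
      (fun l' a h => hA l' a (h.trans hpre))
    have h2 := sub_target_le hΔ hm hr hσ (hA _ g (List.prefix_refl _)).1
    have h3 := (hA l c hpre).2
    have hp := hsort l c g (List.prefix_refl _)
    have hpc := price_pos hΔ hm hr hc
    -- The Abel summation step: the surplus carried over is nonnegative, so dividing it by the
    -- later, larger price only weakens the bound.
    have h4 : (total (slotRevenue A) (l ++ [c]) - 1 / r * optRevenue Δ (l ++ [c])) /
          price Δ r (l ++ [c] ++ [g]) ≤
        (total (slotRevenue A) (l ++ [c]) - 1 / r * optRevenue Δ (l ++ [c])) /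
          price Δ r (l ++ [c]) :=
      div_le_div_of_nonneg_left (by linarith) hpc hp
    rw [total_concat A, total_concat (pursuit Δ r), total_concat (slotRevenue A),
      slotRevenue_concat]
    rw [target_concat] at h2
    rw [show total (slotRevenue A) (l ++ [c]) + g (A (l ++ [c] ++ [g])) -
        1 / r * optRevenue Δ (l ++ [c] ++ [g]) =
      (total (slotRevenue A) (l ++ [c]) - 1 / r * optRevenue Δ (l ++ [c])) +
      (g (A (l ++ [c] ++ [g])) - 1 / r * (optRevenue Δ (l ++ [c] ++ [g]) -
        optRevenue Δ (l ++ [c]))) by ring, add_div]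
    linarith

/-- Competitiveness is needed at every prefix of the reordered input, and is available because each
nonempty prefix is itself an input. -/
lemma total_pursuit_le (hΔ : 0 < Δ) (hm : 0 < m) (hr : 1 < r) {𝒢 : Set (ℝ → ℝ)}
    (h𝒢 : ∀ g ∈ 𝒢, IsRevenueFunction Δ m M g) {A : OnlineAlgorithm} (hA : A.IsFeasible 𝒢 Δ)
    (hcomp : ∀ σ ∈ inputs 𝒢, optRevenue Δ σ ≤ r * revenue σ (A.decisions σ))
    (hσ : σ ∈ inputs 𝒢) : total (pursuit Δ r) σ ≤ Δ := by
  obtain ⟨τ, hτ, hle, hsort⟩ := exists_perm_price_le hΔ hm hr fun f hf => h𝒢 f (hσ.2 f hf)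
  have hτ𝒢 : ∀ f ∈ τ, f ∈ 𝒢 := fun f hf => hσ.2 f (hτ.mem_iff.1 hf)
  have hτne : τ ≠ [] := fun h => hσ.1 (by simpa [h] using hτ)
  obtain ⟨l, g, rfl⟩ : ∃ l g, τ = l ++ [g] := ⟨_, _, (List.dropLast_append_getLast hτne).symm⟩
  have hmem : ∀ l' a, l' ++ [a] <+: l ++ [g] → l' ++ [a] ∈ inputs 𝒢 := fun l' a h =>
    ⟨by simp, fun f hf => hτ𝒢 f (h.subset hf)⟩
  have hcomp' : ∀ l' a, l' ++ [a] <+: l ++ [g] →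
      1 / r * optRevenue Δ (l' ++ [a]) ≤ total (slotRevenue A) (l' ++ [a]) := by
    intro l' a h
    have := hcomp _ (hmem l' a h)
    rw [revenue_decisions] at this
    rw [one_div, inv_mul_le_iff₀ (by linarith)]
    exact this
  have hmain := div_price_le_total_sub hΔ hm hr A l g (fun f hf => h𝒢 f (hτ𝒢 f hf)) hsort
    fun l' a h => ⟨by
      have := mem_Icc_of_mem_feasibleSet le_rfl (hA _ (hmem l' a h)) ⟨l'.length, by simp⟩
      rw [OnlineAlgorithm.decisions, List.take_of_length_le (by simp)] at this
      exact this, hcomp' l' a h⟩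
  have hnonneg : 0 ≤ (total (slotRevenue A) (l ++ [g]) - 1 / r * optRevenue Δ (l ++ [g])) /
      price Δ r (l ++ [g]) :=
    div_nonneg (by linarith [hcomp' l g (List.prefix_refl _)])
      (price_pos hΔ hm hr fun f hf => h𝒢 f (hτ𝒢 f hf)).le
  have hfeas : total A (l ++ [g]) ≤ Δ := (hA _ (hmem l g (List.prefix_refl _))).2
  linarith

end OOIC

namespace OOIC

variable {Δ m M r s : ℝ} {σ : List (ℝ → ℝ)} {𝒢 : Set (ℝ → ℝ)}

/-! ### The characteristic equation and competitive ratios -/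

lemma ofReal_total_pursuit_le (hΔ : 0 ≤ Δ) (hr : 1 ≤ r)
    (h𝒢 : ∀ g ∈ 𝒢, IsRevenueFunction Δ m M g) (hσ : σ ∈ inputs 𝒢) :
    ENNReal.ofReal (total (pursuit Δ r) σ) ≤ worstCaseInventory 𝒢 Δ r :=
  le_iSup₂_of_le σ hσ <| le_iSup₂_of_le ((pursuit Δ r).decisions σ)
    (isCRPursuitOutput_pursuit hΔ hr fun f hf => h𝒢 f (hσ.2 f hf)) le_rfl

/-- Controlling the canonical `pursuit` at `r` suffices, since it bounds every admissible output at
`s`. The uniform factor `r / s` keeps the inequality strict in the supremum. -/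
lemma worstCaseInventory_lt (hΔ : 0 < Δ) (hm : 0 < m) (hr : 1 ≤ r) (hrs : r < s)
    (h𝒢 : ∀ g ∈ 𝒢, IsRevenueFunction Δ m M g)
    (h : ∀ σ ∈ inputs 𝒢, total (pursuit Δ r) σ ≤ Δ) :
    worstCaseInventory 𝒢 Δ s < ENNReal.ofReal Δ := by
  have hq : r / s < 1 := by rw [div_lt_one (by linarith)]; exact hrs
  have hq0 : 0 ≤ r / s := div_nonneg (by linarith) (by linarith)
  refine lt_of_le_of_lt (b := ENNReal.ofReal (r / s * Δ)) ?_ ?_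
  · refine iSup₂_le fun σ hσ => iSup₂_le fun v hv => ENNReal.ofReal_le_ofReal ?_
    exact (sum_le_total_pursuit hΔ hm hr hrs (fun f hf => h𝒢 f (hσ.2 f hf)) hv).trans
      (mul_le_mul_of_nonneg_left (h σ hσ) hq0)
  · rw [ENNReal.ofReal_lt_ofReal_iff hΔ]
    exact mul_lt_of_lt_one_left hΔ hq

lemma worstCaseInventory_lt_of_eq (hΔ : 0 < Δ) (hm : 0 < m) (hr : 1 ≤ r) (hrs : r < s)
    (h𝒢 : ∀ g ∈ 𝒢, IsRevenueFunction Δ m M g)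
    (h : worstCaseInventory 𝒢 Δ r = ENNReal.ofReal Δ) :
    worstCaseInventory 𝒢 Δ s < ENNReal.ofReal Δ :=
  worstCaseInventory_lt hΔ hm hr hrs h𝒢 fun _ hσ => (ENNReal.ofReal_le_ofReal_iff hΔ.le).1
    ((ofReal_total_pursuit_le hΔ.le hr h𝒢 hσ).trans h.le)

lemma total_target (hΔ : 0 ≤ Δ) (r : ℝ) (σ : List (ℝ → ℝ)) :
    total (target Δ r) σ = 1 / r * optRevenue Δ σ := by
  induction σ using List.reverseRecOn with
  | nil => rw [total_nil, optRevenue_nil hΔ, mul_zero]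
  | append_singleton l g ih =>
    rw [total_concat, ih, target_concat]
    ring

/-- CR-Pursuit(`r`) earns the fraction `1 / r` of the optimal offline revenue. -/
lemma revenue_of_isCRPursuitOutput (hΔ : 0 ≤ Δ) {v : Fin σ.length → ℝ}
    (hv : IsCRPursuitOutput Δ r σ v) : revenue σ v = 1 / r * optRevenue Δ σ := by
  rw [← total_target hΔ]
  refine Finset.sum_congr rfl fun t _ => ?_
  rw [target_eq_of_isCRPursuitOutput hv t, List.take_succ_eq_append_getElem t.2]
  rfl

lemma inputs_nonempty (hΔ : 0 < Δ) (h : worstCaseInventory 𝒢 Δ r = ENNReal.ofReal Δ) :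
    (inputs 𝒢).Nonempty := by
  by_contra hne
  rw [Set.not_nonempty_iff_eq_empty] at hne
  have h0 : worstCaseInventory 𝒢 Δ r = 0 := by simp [worstCaseInventory, hne]
  rw [h0] at h
  exact absurd (ENNReal.ofReal_pos.2 hΔ) (by rw [← h]; exact lt_irrefl 0)

lemma OnlineAlgorithm.IsCRPursuit.isFeasible (hΔ : 0 < Δ) {A : OnlineAlgorithm}
    (hA : A.IsCRPursuit 𝒢 Δ r) (h : CRPursuitFeasible 𝒢 Δ r) : A.IsFeasible 𝒢 Δ := by
  intro σ hσ
  refine ⟨fun t => (hA σ hσ t).1.1, (ENNReal.ofReal_le_ofReal_iff hΔ.le).1 (le_trans ?_ h)⟩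
  exact le_iSup₂_of_le σ hσ <| le_iSup₂_of_le (A.decisions σ) (hA σ hσ) le_rfl

lemma OnlineAlgorithm.IsCRPursuit.competitiveRatio_eq (hΔ : 0 < Δ) (hm : 0 < m) (hr : 1 ≤ r)
    (h𝒢 : ∀ g ∈ 𝒢, IsRevenueFunction Δ m M g) (hne : (inputs 𝒢).Nonempty) {A : OnlineAlgorithm}
    (hA : A.IsCRPursuit 𝒢 Δ r) : A.competitiveRatio 𝒢 Δ = ENNReal.ofReal r := by
  have hratio : ∀ σ ∈ inputs 𝒢, ENNReal.ofReal (optRevenue Δ σ) /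
      ENNReal.ofReal (revenue σ (A.decisions σ)) = ENNReal.ofReal r := by
    intro σ hσ
    have hpos := optRevenue_pos hΔ hm (fun f hf => h𝒢 f (hσ.2 f hf)) hσ.1
    rw [revenue_of_isCRPursuitOutput hΔ.le (hA σ hσ), ← ENNReal.ofReal_div_of_pos (by positivity)]
    congr 1
    field_simp
  rw [OnlineAlgorithm.competitiveRatio, biSup_congr hratio]
  exact biSup_const hne

lemma one_le_competitiveRatio (hΔ : 0 < Δ) (hm : 0 < m)
    (h𝒢 : ∀ g ∈ 𝒢, IsRevenueFunction Δ m M g) (hne : (inputs 𝒢).Nonempty) {A : OnlineAlgorithm}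
    (hA : A.IsFeasible 𝒢 Δ) : 1 ≤ A.competitiveRatio 𝒢 Δ := by
  obtain ⟨σ, hσ⟩ := hne
  have hσ' : ∀ f ∈ σ, IsRevenueFunction Δ m M f := fun f hf => h𝒢 f (hσ.2 f hf)
  have hpos := optRevenue_pos hΔ hm hσ' hσ.1
  refine le_iSup₂_of_le σ hσ ?_
  rw [ENNReal.le_div_iff_mul_le (.inr (ENNReal.ofReal_pos.2 hpos).ne')
    (.inr ENNReal.ofReal_ne_top), one_mul]
  exact ENNReal.ofReal_le_ofReal (revenue_le_optRevenue hσ' le_rfl (hA σ hσ))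

lemma optRevenue_le_of_competitiveRatio_le (hΔ : 0 < Δ) (hm : 0 < m) (hr : 0 ≤ r)
    (h𝒢 : ∀ g ∈ 𝒢, IsRevenueFunction Δ m M g) {A : OnlineAlgorithm}
    (h : A.competitiveRatio 𝒢 Δ ≤ ENNReal.ofReal r) (hσ : σ ∈ inputs 𝒢) :
    optRevenue Δ σ ≤ r * revenue σ (A.decisions σ) := by
  have hpos := optRevenue_pos hΔ hm (fun f hf => h𝒢 f (hσ.2 f hf)) hσ.1
  have h1 := (le_iSup₂_of_le σ hσ le_rfl).trans h
  rw [ENNReal.div_le_iff_le_mul (.inr ENNReal.ofReal_ne_top) (.inl ENNReal.ofReal_ne_top),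
    ← ENNReal.ofReal_mul hr] at h1
  by_contra! hlt
  exact absurd h1 (not_le.2 ((ENNReal.ofReal_lt_ofReal_iff hpos).2 hlt))

lemma ofReal_le_competitiveRatio (hΔ : 0 < Δ) (hm : 0 < m)
    (h𝒢 : ∀ g ∈ 𝒢, IsRevenueFunction Δ m M g)
    (hchar : worstCaseInventory 𝒢 Δ r = ENNReal.ofReal Δ) {A : OnlineAlgorithm}
    (hA : A.IsFeasible 𝒢 Δ) : ENNReal.ofReal r ≤ A.competitiveRatio 𝒢 Δ := by
  by_contra! hlt
  -- An intermediate `q` gives both strict inequalities: `1 < q` for positive prices and `q < r` for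
  -- the scaling.
  obtain ⟨q, hq, hqr⟩ := exists_between hlt
  have h1 : 1 < q := (one_le_competitiveRatio hΔ hm h𝒢 (inputs_nonempty hΔ hchar) hA).trans_lt hq
  lift q to NNReal using hqr.ne_top
  have hq1 : 1 < (q : ℝ) := by exact_mod_cast h1
  rw [← ENNReal.ofReal_coe_nnreal] at hq hqr
  have hqr' : (q : ℝ) < r := (ENNReal.ofReal_lt_ofReal_iff_of_nonneg q.2).1 hqr
  refine (worstCaseInventory_lt hΔ hm hq1.le hqr' h𝒢 fun σ hσ => ?_).ne hchar
  exact total_pursuit_le hΔ hm hq1 h𝒢 hA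
    (fun σ hσ => optRevenue_le_of_competitiveRatio_le hΔ hm q.2 h𝒢 hq.le hσ) hσ

end OOIC

theorem theorem6 (Δ m M : ℝ) (hΔ : 0 < Δ) (hm : 0 < m) (hmM : m ≤ M)
    (𝒢 : Set (ℝ → ℝ)) (h𝒢 : ∀ g ∈ 𝒢, OOIC.IsRevenueFunction Δ m M g)
    (π : ℝ) (hπ : 1 ≤ π)
    (hchar : OOIC.worstCaseInventory 𝒢 Δ π = ENNReal.ofReal Δ) :
    -- `π` is the only solution of the characteristic equation
    (∀ π' : ℝ, 1 ≤ π' → OOIC.worstCaseInventory 𝒢 Δ π' = ENNReal.ofReal Δ → π' = π) ∧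
    -- CR-Pursuit(`π`) is a well-defined feasible online algorithm of competitive ratio `π`
    OOIC.CRPursuitFeasible 𝒢 Δ π ∧
    (∃ A : OOIC.OnlineAlgorithm, A.IsCRPursuit 𝒢 Δ π) ∧
    (∀ A : OOIC.OnlineAlgorithm, A.IsCRPursuit 𝒢 Δ π →
      A.IsFeasible 𝒢 Δ ∧ A.competitiveRatio 𝒢 Δ = ENNReal.ofReal π) ∧
    -- `π` is the least competitive ratio among all feasible deterministic online algorithms
    IsLeast {r : ENNReal | ∃ A : OOIC.OnlineAlgorithm,
      A.IsFeasible 𝒢 Δ ∧ A.competitiveRatio 𝒢 Δ = r} (ENNReal.ofReal π) := by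
  have hne := OOIC.inputs_nonempty hΔ hchar
  have hpursuit : (OOIC.pursuit Δ π).IsCRPursuit 𝒢 Δ π := fun σ hσ =>
    OOIC.isCRPursuitOutput_pursuit hΔ.le hπ fun f hf => h𝒢 f (hσ.2 f hf)
  refine ⟨fun π' hπ' h => ?_, hchar.le, ⟨_, hpursuit⟩,
    fun A hA => ⟨hA.isFeasible hΔ hchar.le, hA.competitiveRatio_eq hΔ hm hπ h𝒢 hne⟩,
    ⟨_, hpursuit.isFeasible hΔ hchar.le, hpursuit.competitiveRatio_eq hΔ hm hπ h𝒢 hne⟩, ?_⟩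
  · rcases lt_trichotomy π' π with hlt | heq | hlt
    · exact absurd hchar (OOIC.worstCaseInventory_lt_of_eq hΔ hm hπ' hlt h𝒢 h).ne
    · exact heq
    · exact absurd h (OOIC.worstCaseInventory_lt_of_eq hΔ hm hπ hlt h𝒢 hchar).ne
  · rintro _ ⟨A, hA, rfl⟩
    exact OOIC.ofReal_le_competitiveRatio hΔ hm h𝒢 hchar hA
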